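/- Notation. $\mathbb{N}^*=\{1,2,3,\dots\}$, and $S$ is the left shift on $\{-1,0,1\}^{\mathbb{N}^*}$, $(Sw)(n)=w(n+1)$. A sequence $w$ is quasi-generic for a shift-invariant Borel probability measure $\nu$ if, for some increasing sequence $(N_k)$, the measures $\frac1{N_k}\sum_{n=1}^{N_k}\delta_{S^nw}$ converge weakly to $\nu$. A sequence $t$ is Toeplitz if for every $a\in\mathbb{N}^*$ there is $r_a\in\mathbb{N}^*$ such that $t(a+kr_a)=t(a)$ for all $k\in\mathbb{N}^*$. Further, $h_{top}(t)=\lim_{n\to\infty}\frac1n\log_2 p_n(t)$, where $p_n(t)$ is the number of blocks of length $n$ appearing in $t$, and $h_{top}(\operatorname{supp}\nu)=\lim_{n\to\infty}\frac1n\log_2 p_n(\operatorname{supp}\nu)$, where $p_n(\operatorname{supp}\nu)$ is the number of blocks of length $n$ whose cylinder set has positive $\nu$-measure. Theorem. Let $z\in\{-1,0,1\}^{\mathbb{N}^*}$ satisfy $$\liminf_{N\to\infty}\frac1N\sum_{n\le N}z(n)^2>0 .$$ Suppose moreover that (a) $z^2=(z(n)^2)_{n\ge1}$ is quasi-generic for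 some shift-invariant Borel probability measure $\nu$ on $\{-1,0,1\}^{\mathbb{N}^*}$; (b) $H:=h_{top}(\operatorname{supp}\nu)>0$; (c) there exist integers $q\ge2$ and $b\ge1$ such that, for all $m\ge1$, the measure $\nu$ has at most $b$ ergodic components under $S^{q^m}$ (that is, $\nu$ is a convex combination of at most $b$ ergodic $S^{q^m}$-invariant probability measures). Then, for every $\varepsilon>0$, there is a Toeplitz sequence $t\in\{-1,0,1\}^{\mathbb{N}^*}$ such that $$h_{top}(t)\ge(1-\varepsilon)H\qquad\text{and}\qquad \liminf_{N\to\infty}\frac1N\sum_{n\le N}t(n)\,z(n)>0 .$$ -/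

import Mathlib

open MeasureTheory Filter Topology
open scoped ENNReal

noncomputable section

/-! Sequences over an alphabet `A` are functions `ℕ+ → A`; the alphabet `{-1, 0, 1}` is `SignType`
(discrete topology and discrete σ-algebra), with its usual multiplication and its cast to `ℝ`. -/

instance instMeasurableSpaceSignType : MeasurableSpace SignType := ⊤

instance instDiscreteMeasurableSpaceSignType : DiscreteMeasurableSpace SignType :=
  ⟨fun _ => MeasurableSpace.measurableSet_top⟩

instance instBorelSpaceSignType : BorelSpace SignType :=
  ⟨(borel_eq_top_of_discrete (α := SignType)).symm⟩

/-- The left shift `S` on `A^ℕ*`: `(S w) n = w (n + 1)`. -/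
def seqShift {A : Type*} (w : ℕ+ → A) : ℕ+ → A := fun n => w (n + 1)

/-- The position `t + i`, for `t ∈ ℕ*` and `i ≥ 0`. -/
def posAdd (t : ℕ+) (i : ℕ) : ℕ+ := ⟨(t : ℕ) + i, Nat.add_pos_left t.pos i⟩

theorem coe_posAdd (t : ℕ+) (i : ℕ) : (posAdd t i : ℕ) = t + i := rfl

/-- The cylinder `C_t(B)` of all `w` with `w (t + i) = B i` for `0 ≤ i < n`. -/
def blockCylinder {A : Type*} {n : ℕ} (t : ℕ+) (B : Fin n → A) : Set (ℕ+ → A) :=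
  {w | ∀ i : Fin n, w (posAdd t i) = B i}

/-- The set of blocks of length `n` that appear in `w`. -/
def blocks {A : Type*} (w : ℕ+ → A) (n : ℕ) : Set (Fin n → A) :=
  {B | ∃ t : ℕ+, w ∈ blockCylinder t B}

/-- The set of blocks of length `n` of positive `ν`-measure. -/
def suppBlocks {A : Type*} [MeasurableSpace A] (ν : Measure (ℕ+ → A)) (n : ℕ) :
    Set (Fin n → A) :=
  {B | 0 < ν (blockCylinder 1 B)}

/-- `lim (1/n) log₂ |L n|`, for a family `L` of sets of blocks (`L n` consisting of blocks of
length `n`). -/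
def growthRate {A : Type*} (L : ∀ n : ℕ, Set (Fin n → A)) : ℝ :=
  limUnder atTop fun n : ℕ => Real.logb 2 ((L n).ncard : ℝ) / n

/-- The topological entropy `h_top(w)` of a sequence (base-2 logarithm). -/
def topEntropy {A : Type*} (w : ℕ+ → A) : ℝ := growthRate (blocks w)

/-- The topological entropy `h_top(supp ν)` of the support of a shift-invariant measure
(base-2 logarithm). -/
def suppEntropy {A : Type*} [MeasurableSpace A] (ν : Measure (ℕ+ → A)) : ℝ :=
  growthRate (suppBlocks ν)

/-- The average `(1/N) ∑_{n = 1}^{N} f n`. -/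
def prefixAverage (f : ℕ+ → ℝ) (N : ℕ) : ℝ := (∑ n ∈ Finset.range N, f n.succPNat) / N

/-- A sequence `t` is Toeplitz if for each position `a` there is a period `r ≥ 1` with
`t (a + k r) = t a` for all `k`. -/
def IsToeplitz {A : Type*} (t : ℕ+ → A) : Prop :=
  ∀ a : ℕ+, ∃ r : ℕ+, ∀ k : ℕ+, t a = t (a + k * r)

/-- The empirical measure `δ_{N,x} = (1/N) ∑_{n = 1}^{N} δ_{T^n x}`. -/
def empiricalMeasure {X : Type*} [MeasurableSpace X] (T : X → X) (x : X) (N : ℕ) : Measure X :=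
  (N : ℝ≥0∞)⁻¹ • ∑ n ∈ Finset.Icc 1 N, Measure.dirac (T^[n] x)

/-- `x` is quasi-generic for `ν`: along some increasing sequence `N_k`, the empirical measures
`δ_{N_k,x}` converge weakly to `ν`. -/
def IsQuasiGeneric {X : Type*} [TopologicalSpace X] [MeasurableSpace X] (T : X → X) (x : X)
    (ν : Measure X) : Prop :=
  ∃ N : ℕ → ℕ, StrictMono N ∧ ∀ f : C(X, ℝ),
    Tendsto (fun k => ∫ y, f y ∂(empiricalMeasure T x (N k))) atTop (𝓝 (∫ y, f y ∂ν))

/-- The system `(T, ν)` has at most `b` ergodic components: `ν` is a convex combination, with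
positive weights, of at most `b` (distinct) `T`-invariant ergodic probability measures. -/
def HasAtMostErgodicComponents {X : Type*} [MeasurableSpace X] (T : X → X) (ν : Measure X)
    (b : ℕ) : Prop :=
  ∃ (E : Finset (Measure X)) (α : Measure X → ℝ≥0∞), E.card ≤ b ∧
    (∀ ρ ∈ E, IsProbabilityMeasure ρ ∧ Ergodic T ρ ∧ 0 < α ρ) ∧
    ∑ ρ ∈ E, α ρ = 1 ∧ ν = ∑ ρ ∈ E, α ρ • ρ

/-! The limits that define the two entropies exist. -/

theorem tendsto_growthRate {A : Type*} [Finite A] {L : ∀ n : ℕ, Set (Fin n → A)}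
    (hne : ∀ n, (L n).Nonempty)
    (hl : ∀ m n (B : Fin (m + n) → A), B ∈ L (m + n) → (fun i => B (Fin.castAdd n i)) ∈ L m)
    (hr : ∀ m n (B : Fin (m + n) → A), B ∈ L (m + n) → (fun i => B (Fin.natAdd m i)) ∈ L n) :
    Tendsto (fun n : ℕ => Real.logb 2 ((L n).ncard : ℝ) / n) atTop (𝓝 (growthRate L)) := by
  have hpos : ∀ n, 0 < (L n).ncard := fun n => (Set.ncard_pos (Set.toFinite _)).2 (hne n)
  have hmul : ∀ m n, (L (m + n)).ncard ≤ (L m).ncard * (L n).ncard := by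
    intro m n
    rw [← Set.ncard_prod]
    refine Set.ncard_le_ncard_of_injOn
      (fun B => (fun i => B (Fin.castAdd n i), fun i => B (Fin.natAdd m i))) ?_ ?_
      (Set.toFinite _)
    · intro B hB
      exact ⟨hl m n B hB, hr m n B hB⟩
    · intro B _ B' _ h
      funext i
      refine Fin.addCases (fun j => ?_) (fun j => ?_) i
      · exact congrFun (congrArg Prod.fst h) j
      · exact congrFun (congrArg Prod.snd h) j
  have hsub : Subadditive fun n => Real.logb 2 ((L n).ncard : ℝ) := by
    intro m n
    have hm : ((L m).ncard : ℝ) ≠ 0 := by exact_mod_cast (hpos m).ne'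
    have hn : ((L n).ncard : ℝ) ≠ 0 := by exact_mod_cast (hpos n).ne'
    rw [← Real.logb_mul hm hn]
    refine Real.logb_le_logb_of_le (by norm_num) (by exact_mod_cast hpos (m + n)) ?_
    exact_mod_cast hmul m n
  have hbdd : BddBelow (Set.range fun n : ℕ => Real.logb 2 ((L n).ncard : ℝ) / n) := by
    refine ⟨0, ?_⟩
    rintro _ ⟨n, rfl⟩
    refine div_nonneg (Real.logb_nonneg (by norm_num) ?_) (Nat.cast_nonneg n)
    exact_mod_cast hpos n
  exact tendsto_nhds_limUnder ⟨_, hsub.tendsto_lim hbdd⟩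

theorem tendsto_topEntropy {A : Type*} [Finite A] (w : ℕ+ → A) :
    Tendsto (fun n : ℕ => Real.logb 2 ((blocks w n).ncard : ℝ) / n) atTop
      (𝓝 (topEntropy w)) := by
  refine tendsto_growthRate (fun n => ⟨_, 1, fun i => rfl⟩) ?_ ?_
  · rintro m n B ⟨t, ht⟩
    exact ⟨t, fun i => ht (Fin.castAdd n i)⟩
  · rintro m n B ⟨t, ht⟩
    refine ⟨posAdd t m, fun i => ?_⟩
    refine Eq.trans (congrArg w (PNat.eq ?_)) (ht (Fin.natAdd m i))
    simp [coe_posAdd, add_assoc]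

theorem seqShift_iterate {A : Type*} (m : ℕ) (w : ℕ+ → A) (n : ℕ+) :
    seqShift^[m] w n = w (posAdd n m) := by
  induction m generalizing w with
  | zero => rfl
  | succ m ih =>
    rw [Function.iterate_succ_apply, ih]
    exact congrArg w (PNat.eq (by simp only [coe_posAdd, PNat.add_coe, PNat.one_coe]; omega))

theorem measurableSet_blockCylinder {A : Type*} [MeasurableSpace A] [MeasurableSingletonClass A]
    {n : ℕ} (t : ℕ+) (B : Fin n → A) : MeasurableSet (blockCylinder t B) := by
  have h : blockCylinder t B =
      ⋂ i : Fin n, (fun w : ℕ+ → A => w (posAdd t i)) ⁻¹' {B i} := by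
    ext w
    simp only [blockCylinder, Set.mem_ofPred_eq, Set.mem_iInter, Set.mem_preimage,
      Set.mem_singleton_iff]
  rw [h]
  exact MeasurableSet.iInter fun i => measurable_pi_apply _ (measurableSet_singleton _)

theorem tendsto_suppEntropy {A : Type*} [Finite A] [MeasurableSpace A]
    [MeasurableSingletonClass A] (ν : Measure (ℕ+ → A)) [IsProbabilityMeasure ν]
    (hν : MeasurePreserving seqShift ν ν) :
    Tendsto (fun n : ℕ => Real.logb 2 ((suppBlocks ν n).ncard : ℝ) / n) atTop
      (𝓝 (suppEntropy ν)) := by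
  refine tendsto_growthRate (fun n => ?_) ?_ ?_
  · by_contra h
    have h0 : ∀ B : Fin n → A, ν (blockCylinder 1 B) = 0 := by
      intro B
      by_contra hB
      exact h ⟨B, pos_iff_ne_zero.2 hB⟩
    have hU : (⋃ B : Fin n → A, blockCylinder 1 B) = Set.univ :=
      Set.eq_univ_of_forall fun w => Set.mem_iUnion.2 ⟨_, fun i => rfl⟩
    have : ν Set.univ = 0 := by
      rw [← hU]
      exact measure_iUnion_null h0
    simp at this
  · intro m n B (hB : 0 < ν (blockCylinder 1 B))
    exact lt_of_lt_of_le hB (measure_mono fun w hw i => hw (Fin.castAdd n i))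
  · intro m n B (hB : 0 < ν (blockCylinder 1 B))
    refine lt_of_lt_of_le hB ?_
    rw [← (hν.iterate m).measure_preimage
      (measurableSet_blockCylinder 1 fun i => B (Fin.natAdd m i)).nullMeasurableSet]
    refine measure_mono fun w hw i => ?_
    rw [seqShift_iterate]
    refine Eq.trans (congrArg w (PNat.eq ?_)) (hw (Fin.natAdd m i))
    simp only [coe_posAdd, Fin.val_natAdd]
    omega

end

/-! The sequence `t` copies `z` except on a sparse periodic-like set. Take periods p_0 ∣ p_1 ∣ ...
with p_i / p_{i+1} tiny. Level i fills each class modulo p_{i+1} that starts below p_i, where no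
earlier level applies, with the value of `z` at its first member. So `t` can differ from `z` only at
later members of such classes (`repeated`).

Correlation: the densities p_i / p_{i+1} sum to at most δ, so at most δN of the first N terms change
(`card_repeated_le`), and each change costs at most 2.

Entropy: let M = (j+1) p_j. The finitely many blocks of length M in the support of ν all have
measure above some f_M > 0. The ratios p_i / p_{i+1} with i ≥ j are chosen small relative to f_M, so
repetitions of levels ≥ j cannot meet every occurrence of such a block B in z². At an occurrence
that escapes them, t² equals B outside at most δM places, which depend only on the start modulo p_j.
Hence B is determined by a residue, a block of `t` and at most δM symbols (`ncard_suppBlocks_le`).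
Taking logarithms and letting j grow gives H ≤ h_top(t) + 2δ. -/

/-- Period structures that grow as fast as prescribed. -/
theorem exists_dvd_chain (c : ℕ → ℝ) (hc : ∀ M, 0 < c M) :
    ∃ p : ℕ → ℕ, (∀ i, 0 < p i) ∧ (∀ i, p i ∣ p (i + 1)) ∧ (∀ i, i < p i) ∧
      ∀ i M, M ≤ (i + 1) * p i → (p i : ℝ) ≤ c M * (1 / 2) ^ (i + 1) * p (i + 1) := by
  -- The sum dominates every `(c M)⁻¹` with M ≤ (i+1)a at once; the `+ 2` makes the periods at least
  -- double, whence `i < p i`.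
  let K : ℕ → ℕ → ℕ := fun i a =>
    ⌈2 ^ (i + 1) * ∑ M ∈ Finset.range ((i + 1) * a + 1), (c M)⁻¹⌉₊ + 2
  obtain ⟨p, hp0, hs⟩ : ∃ p : ℕ → ℕ, p 0 = 1 ∧ ∀ i, p (i + 1) = p i * K i (p i) :=
    ⟨fun i => Nat.rec 1 (fun i a => a * K i a) i, rfl, fun _ => rfl⟩
  have hpos : ∀ i, 0 < p i := by
    intro i
    induction i with
    | zero => simp [hp0]
    | succ i ih => rw [hs]; exact Nat.mul_pos ih (Nat.succ_pos _)
  refine ⟨p, hpos, fun i => ⟨_, hs i⟩, ?_, ?_⟩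
  · intro i
    induction i with
    | zero => simp [hp0]
    | succ i ih =>
      rw [hs]
      have : 2 ≤ K i (p i) := Nat.le_add_left _ _
      nlinarith
  · intro i M hM
    have h1 : (c M)⁻¹ ≤ ∑ M ∈ Finset.range ((i + 1) * p i + 1), (c M)⁻¹ :=
      Finset.single_le_sum (f := fun M => (c M)⁻¹) (fun M _ => (inv_pos.2 (hc M)).le)
        (Finset.mem_range.2 (Nat.lt_succ_of_le hM))
    have h2 : 2 ^ (i + 1) * (c M)⁻¹ ≤ (K i (p i) : ℝ) := by
      refine (mul_le_mul_of_nonneg_left h1 (by positivity)).trans ?_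
      refine (Nat.le_ceil _).trans ?_
      simp only [K, Nat.cast_add]
      norm_num
    have h3 : 1 ≤ c M * (1 / 2) ^ (i + 1) * (K i (p i) : ℝ) := by
      have hcM := hc M
      calc (1 : ℝ) = c M * (1 / 2) ^ (i + 1) * (2 ^ (i + 1) * (c M)⁻¹) := by
            rw [one_div, inv_pow]; field_simp
        _ ≤ _ := mul_le_mul_of_nonneg_left h2 (by positivity)
    rw [hs, Nat.cast_mul]
    have h4 := mul_le_mul_of_nonneg_left h3 (Nat.cast_nonneg (α := ℝ) (p i))
    exact (mul_one _).symm.le.trans (h4.trans_eq (by ring))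

/-! ### The Toeplitz construction, with positions counted from 0 -/

section Toeplitz

variable {A : Type*} (p : ℕ → ℕ)

/-- The first `i` for which `n` lies, modulo `p (i + 1)`, in the initial segment of length
`p i`. -/
def toeplitzLevel (hp : ∀ i, i < p i) (hm : Monotone p) (n : ℕ) : ℕ :=
  Nat.find (p := fun i => n % p (i + 1) < p i)
    ⟨n, by rw [Nat.mod_eq_of_lt ((hp n).trans_le (hm n.le_succ))]; exact hp n⟩

/-- The Toeplitz sequence that copies `z` at the first occurrence of every residue class
`n` modulo `p (toeplitzLevel n + 1)`. -/
def toeplitzCopy (hp : ∀ i, i < p i) (hm : Monotone p) (z : ℕ → A) (n : ℕ) : A :=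
  z (n % p (toeplitzLevel p hp hm n + 1))

/-- The positions at which, at some level `≥ j`, a value is repeated. -/
def repeated (j n : ℕ) : Prop := ∃ i, j ≤ i ∧ p (i + 1) ≤ n ∧ n % p (i + 1) < p i

variable {p}

/-- The level l of n is decided by the residues of n modulo p_1, ..., p_{l+1}, all of which divide
p_{l+1}. -/
theorem toeplitzLevel_add (hp : ∀ i, i < p i) (hm : Monotone p)
    (hd : ∀ i j, i ≤ j → p i ∣ p j) (n k : ℕ) :
    toeplitzLevel p hp hm (n + k * p (toeplitzLevel p hp hm n + 1)) = toeplitzLevel p hp hm n := by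
  set l := toeplitzLevel p hp hm n with hl
  have key : ∀ i ≤ l, (n + k * p (l + 1)) % p (i + 1) = n % p (i + 1) := by
    intro i hi
    obtain ⟨c, hc⟩ := hd (i + 1) (l + 1) (by omega)
    rw [hc, mul_left_comm, Nat.add_mul_mod_self_left]
  unfold toeplitzLevel
  rw [Nat.find_eq_iff]
  refine ⟨?_, fun i hi => ?_⟩
  · rw [key l le_rfl]
    exact Nat.find_spec (p := fun i => n % p (i + 1) < p i) _
  · rw [key i hi.le]
    exact Nat.find_min (p := fun i => n % p (i + 1) < p i) _ hi

theorem toeplitzCopy_add (hp : ∀ i, i < p i) (hm : Monotone p)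
    (hd : ∀ i j, i ≤ j → p i ∣ p j) (z : ℕ → A) (n k : ℕ) :
    toeplitzCopy p hp hm z (n + k * p (toeplitzLevel p hp hm n + 1)) =
      toeplitzCopy p hp hm z n := by
  unfold toeplitzCopy
  rw [toeplitzLevel_add hp hm hd, Nat.add_mul_mod_self_right]

theorem toeplitzCopy_eq (hp : ∀ i, i < p i) (hm : Monotone p) (z : ℕ → A) (n : ℕ)
    (h : ¬ repeated p 0 n) : toeplitzCopy p hp hm z n = z n := by
  unfold toeplitzCopy
  rw [Nat.mod_eq_of_lt]
  by_contra hn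
  exact h ⟨_, Nat.zero_le _, not_lt.1 hn,
    Nat.find_spec (p := fun i => n % p (i + 1) < p i) _⟩

end Toeplitz

/-! ### Densities of the repeated positions -/

theorem card_filter_mod_lt_Ico {q a : ℕ} (ha : a ≤ q) (s l : ℕ) :
    ((Finset.Ico s (s + l * q)).filter fun n => n % q < a).card = l * a := by
  have hq : Function.Periodic (fun n => n % q < a) q := fun n => by simp
  induction l with
  | zero => simp
  | succ l ih =>
    have h1 : Finset.Ico s (s + (l + 1) * q) =
        Finset.Ico s (s + l * q) ∪ Finset.Ico (s + l * q) (s + l * q + q) := by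
      rw [Finset.Ico_union_Ico_eq_Ico (by omega) (by omega)]
      congr 1; ring
    rw [h1, Finset.filter_union, Finset.card_union_of_disjoint, ih,
      Nat.filter_Ico_card_eq_of_periodic _ _ _ hq, Nat.count_eq_card_filter_range]
    · have : (Finset.range q).filter (fun n => n % q < a) = Finset.range a := by
        ext n
        simp only [Finset.mem_filter, Finset.mem_range]
        constructor
        · rintro ⟨h, h'⟩; rwa [Nat.mod_eq_of_lt h] at h'
        · intro h; exact ⟨by omega, by rwa [Nat.mod_eq_of_lt (by omega)]⟩
      rw [this, Finset.card_range]; ring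
    · exact Finset.disjoint_filter_filter (Finset.Ico_disjoint_Ico_consecutive _ _ _)

/-- Discarding the first period pays for the incomplete last one, so the density bound holds for
every N without an error term. -/
theorem card_filter_le_mod_lt {q a : ℕ} (hq : 0 < q) (ha : a ≤ q) (N : ℕ) :
    ((Finset.range N).filter fun n => q ≤ n ∧ n % q < a).card * q ≤ N * a := by
  have h : ((Finset.range N).filter fun n => q ≤ n ∧ n % q < a).card ≤ (N / q) * a := by
    rw [← card_filter_mod_lt_Ico ha q (N / q)]
    refine Finset.card_le_card fun n hn => ?_
    simp only [Finset.mem_filter, Finset.mem_range, Finset.mem_Ico] at hn ⊢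
    refine ⟨⟨hn.2.1, ?_⟩, hn.2.2⟩
    have := Nat.lt_div_mul_add (a := N) hq
    omega
  calc _ ≤ (N / q) * a * q := Nat.mul_le_mul_right _ h
    _ = (N / q) * q * a := by ring
    _ ≤ N * a := Nat.mul_le_mul_right _ (Nat.div_mul_le_self _ _)

theorem sum_half_pow_le_one (s : Finset ℕ) : ∑ i ∈ s, (1 / 2 : ℝ) ^ (i + 1) ≤ 1 := by
  have h : HasSum (fun i : ℕ => (1 / 2 : ℝ) ^ (i + 1)) 1 := by
    have := (hasSum_geometric_two).mul_right (1 / 2 : ℝ)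
    simpa [pow_succ] using this
  exact sum_le_hasSum s (fun i _ => by positivity) h

open Classical in
theorem card_repeated_le {p : ℕ → ℕ} (hp : ∀ i, i < p i) (hm : Monotone p) {j : ℕ} {c : ℝ}
    (hc : 0 ≤ c) (h : ∀ i, j ≤ i → (p i : ℝ) ≤ c * (1 / 2) ^ (i + 1) * p (i + 1)) (N : ℕ) :
    (((Finset.range N).filter (repeated p j)).card : ℝ) ≤ c * N := by
  -- Only levels i < N matter, because i + 1 < p_{i+1} ≤ n < N.
  have hsub : (Finset.range N).filter (repeated p j) ⊆
      ((Finset.range N).filter (j ≤ ·)).biUnion fun i =>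
        (Finset.range N).filter fun n => p (i + 1) ≤ n ∧ n % p (i + 1) < p i := by
    intro n hn
    obtain ⟨hn, i, hij, hi⟩ := Finset.mem_filter.1 hn
    refine Finset.mem_biUnion.2 ⟨i, ?_, Finset.mem_filter.2 ⟨hn, hi⟩⟩
    have := hp (i + 1)
    simp only [Finset.mem_filter, Finset.mem_range] at hn ⊢
    omega
  calc (((Finset.range N).filter (repeated p j)).card : ℝ)
      ≤ ∑ i ∈ (Finset.range N).filter (j ≤ ·),
        (((Finset.range N).filter fun n => p (i + 1) ≤ n ∧ n % p (i + 1) < p i).card : ℝ) := by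
        exact_mod_cast (Finset.card_le_card hsub).trans Finset.card_biUnion_le
    _ ≤ ∑ i ∈ (Finset.range N).filter (j ≤ ·), c * N * (1 / 2) ^ (i + 1) := by
        refine Finset.sum_le_sum fun i hi => ?_
        have hq : 0 < p (i + 1) := (Nat.zero_le _).trans_lt (hp _)
        have h1 : ((((Finset.range N).filter fun n =>
            p (i + 1) ≤ n ∧ n % p (i + 1) < p i).card : ℝ)) * p (i + 1) ≤ N * p i := by
          exact_mod_cast card_filter_le_mod_lt hq (hm i.le_succ) N
        have h2 := mul_le_mul_of_nonneg_left (h i (Finset.mem_filter.1 hi).2)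
          (Nat.cast_nonneg (α := ℝ) N)
        refine le_of_mul_le_mul_right ((h1.trans h2).trans_eq ?_) (Nat.cast_pos.2 hq)
        ring
    _ ≤ c * N := by
        rw [← Finset.mul_sum]
        exact mul_le_of_le_one_right (by positivity) (sum_half_pow_le_one _)

open Classical in
-- For i < j the window consists of whole periods p_{i+1}, so each level's count is exact wherever
-- the window starts.
theorem card_window_le {p : ℕ → ℕ} (hm : Monotone p) (hp : ∀ i, 0 < p i)
    (hd : ∀ i j, i ≤ j → p i ∣ p j) {c : ℝ}
    (hc : 0 ≤ c) (h : ∀ i, (p i : ℝ) ≤ c * (1 / 2) ^ (i + 1) * p (i + 1)) (j k s : ℕ) :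
    (((Finset.Ico s (s + k * p j)).filter
      fun n => ∃ i < j, n % p (i + 1) < p i).card : ℝ) ≤ c * (k * p j : ℕ) := by
  have hsub : (Finset.Ico s (s + k * p j)).filter (fun n => ∃ i < j, n % p (i + 1) < p i) ⊆
      (Finset.range j).biUnion fun i =>
        (Finset.Ico s (s + k * p j)).filter fun n => n % p (i + 1) < p i := by
    intro n hn
    obtain ⟨hn, i, hij, hi⟩ := Finset.mem_filter.1 hn
    exact Finset.mem_biUnion.2 ⟨i, Finset.mem_range.2 hij, Finset.mem_filter.2 ⟨hn, hi⟩⟩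
  calc _ ≤ ∑ i ∈ Finset.range j,
        (((Finset.Ico s (s + k * p j)).filter fun n => n % p (i + 1) < p i).card : ℝ) := by
        exact_mod_cast (Finset.card_le_card hsub).trans Finset.card_biUnion_le
    _ ≤ ∑ i ∈ Finset.range j, c * (k * p j : ℕ) * (1 / 2) ^ (i + 1) := by
        refine Finset.sum_le_sum fun i hi => ?_
        obtain ⟨e, he⟩ := hd (i + 1) j (Finset.mem_range.1 hi)
        have hq : (0 : ℝ) < p (i + 1) := Nat.cast_pos.2 (hp _)
        have h1 : k * p j = (k * e) * p (i + 1) := by rw [he]; ring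
        rw [h1, card_filter_mod_lt_Ico (hm i.le_succ)]
        have h2 := mul_le_mul_of_nonneg_left (h i) (Nat.cast_nonneg (α := ℝ) (k * e))
        push_cast at h2 ⊢
        exact h2.trans_eq (by ring)
    _ ≤ _ := by
        rw [← Finset.mul_sum]
        exact mul_le_of_le_one_right (by positivity) (sum_half_pow_le_one _)

/-! ### Block frequencies and counting -/

theorem isClopen_blockCylinder {A : Type*} [TopologicalSpace A] [DiscreteTopology A] {n : ℕ}
    (t : ℕ+) (B : Fin n → A) : IsClopen (blockCylinder t B) := by
  have h : blockCylinder t B =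
      ⋂ i : Fin n, (fun w : ℕ+ → A => w (posAdd t i)) ⁻¹' {B i} := by
    ext w
    simp [blockCylinder]
  rw [h]
  exact isClopen_iInter_of_finite fun i =>
    (isClopen_discrete {B i}).preimage (continuous_apply _)

open Classical in
theorem empiricalMeasure_real {X : Type*} [MeasurableSpace X] (T : X → X) (x : X) (N : ℕ)
    {C : Set X} (hC : MeasurableSet C) :
    (empiricalMeasure T x N).real C =
      (((Finset.Icc 1 N).filter fun n => T^[n] x ∈ C).card : ℝ) / N := by
  have h : (∑ n ∈ Finset.Icc 1 N, Measure.dirac (T^[n] x)) C =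
      (((Finset.Icc 1 N).filter fun n => T^[n] x ∈ C).card : ℝ≥0∞) := by
    rw [Measure.finsetSum_apply, Finset.card_filter, Nat.cast_sum]
    refine Finset.sum_congr rfl fun n _ => ?_
    rw [Measure.dirac_apply' _ hC]
    by_cases hn : T^[n] x ∈ C <;> simp [hn]
  rw [Measure.real, empiricalMeasure, Measure.smul_apply, h]
  simp [div_eq_inv_mul]

open Classical in
-- Cylinders are clopen, so weak convergence applies to their indicators; it yields arbitrarily
-- large N, which suffices.
theorem IsQuasiGeneric.exists_frequency_gt {A : Type*} [TopologicalSpace A] [DiscreteTopology A]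
    [MeasurableSpace A] [MeasurableSingletonClass A] {w : ℕ+ → A} {ν : Measure (ℕ+ → A)}
    (h : IsQuasiGeneric seqShift w ν) {n : ℕ} (B : Fin n → A) {f : ℝ}
    (hf : f < ν.real (blockCylinder 1 B)) (N₀ : ℕ) :
    ∃ N, N₀ ≤ N ∧ 0 < N ∧
      f * N < (((Finset.Icc 1 N).filter fun s => ∀ i : Fin n, w (Nat.succPNat (s + i)) = B i).card : ℝ) := by
  obtain ⟨N, hN, hlim⟩ := h
  have hmeas := measurableSet_blockCylinder 1 B
  let g : C(ℕ+ → A, ℝ) :=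
    ⟨(blockCylinder 1 B).indicator 1, (isClopen_blockCylinder 1 B).continuous_indicator
      continuous_one⟩
  have hg : ∀ μ : Measure (ℕ+ → A), ∫ y, g y ∂μ = μ.real (blockCylinder 1 B) := fun μ =>
    integral_indicator_one hmeas
  have hl := hlim g
  simp only [hg] at hl
  obtain ⟨k, hk, hk'⟩ :=
    ((hl.eventually_const_lt hf).and (eventually_ge_atTop (N₀ + 1))).exists
  have hkN : k ≤ N k := hN.id_le k
  refine ⟨N k, by omega, by omega, ?_⟩
  have hpos : (0 : ℝ) < N k := by exact_mod_cast (by omega : 0 < N k)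
  rw [empiricalMeasure_real _ _ _ hmeas, lt_div_iff₀ hpos] at hk
  refine hk.trans_le (Nat.cast_le.2 (Finset.card_le_card fun s hs => ?_))
  obtain ⟨hs, hs'⟩ := Finset.mem_filter.1 hs
  refine Finset.mem_filter.2 ⟨hs, fun i => ?_⟩
  rw [← hs' i, seqShift_iterate]
  refine congrArg w (PNat.eq ?_)
  simp only [coe_posAdd, Nat.succPNat_coe, PNat.one_coe]
  omega

theorem exists_pos_le_suppBlocks {A : Type*} [Finite A] [MeasurableSpace A]
    (ν : Measure (ℕ+ → A)) [IsFiniteMeasure ν] (n : ℕ) :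
    ∃ f : ℝ, 0 < f ∧ ∀ B ∈ suppBlocks ν n, f < ν.real (blockCylinder 1 B) := by
  have h : ∀ᶠ f : ℝ in 𝓝[>] 0, ∀ B ∈ suppBlocks ν n, f < ν.real (blockCylinder 1 B) := by
    rw [(Set.toFinite (suppBlocks ν n)).eventually_all]
    intro B hB
    have hB' : 0 < ν.real (blockCylinder 1 B) :=
      ENNReal.toReal_pos (ne_of_gt hB) (measure_ne_top _ _)
    exact mem_nhdsWithin_of_mem_nhds (Iio_mem_nhds hB')
  obtain ⟨f, hf, hf'⟩ := (h.and self_mem_nhdsWithin).exists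
  exact ⟨f, hf', hf⟩

theorem ncard_agree_off_le {A : Type*} [Fintype A] {n : ℕ} (E : Finset (Fin n)) (T : Fin n → A) :
    {B : Fin n → A | ∀ i ∉ E, B i = T i}.ncard ≤ Fintype.card A ^ E.card := by
  have h := Set.ncard_le_ncard_of_injOn (s := {B : Fin n → A | ∀ i ∉ E, B i = T i})
    (t := (Set.univ : Set (E → A))) (fun B i => B i) (fun _ _ => Set.mem_univ _) ?_
    (Set.toFinite _)
  · refine h.trans_eq ?_
    rw [Set.ncard_univ, Nat.card_eq_fintype_card, Fintype.card_fun, Fintype.card_coe]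
  · intro B hB B' hB' hBB'
    funext i
    by_cases hi : i ∈ E
    · exact congrFun hBB' ⟨i, hi⟩
    · rw [hB i hi, hB' i hi]

open Classical in
/-- Counting windows of length `n` that avoid a sparse set. -/
theorem card_windows_hitting_le (P : ℕ → Prop) (n N L : ℕ) (hL : N + n ≤ L) :
    ((Finset.Icc 1 N).filter fun s => ∃ i : Fin n, P (s + i)).card ≤
      n * ((Finset.range L).filter P).card := by
  have hsub : ((Finset.Icc 1 N).filter fun s => ∃ i : Fin n, P (s + i)) ⊆
      (Finset.univ : Finset (Fin n)).biUnion fun i => (Finset.Icc 1 N).filter fun s => P (s + i) := by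
    intro s hs
    obtain ⟨hs, i, hi⟩ := Finset.mem_filter.1 hs
    exact Finset.mem_biUnion.2 ⟨i, Finset.mem_univ _, Finset.mem_filter.2 ⟨hs, hi⟩⟩
  refine (Finset.card_le_card hsub).trans ((Finset.card_biUnion_le_card_mul _ _ _
    fun i _ => ?_).trans_eq (by rw [Finset.card_fin]))
  refine Finset.card_le_card_of_injOn (fun s => s + i) ?_ fun a _ b _ => by simp
  intro s hs
  simp only [Finset.coe_filter, Finset.mem_Icc, Finset.mem_range, Set.mem_ofPred_eq] at hs ⊢
  exact ⟨by have := i.2; omega, hs.2⟩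

/-! ### Correlation with `z` -/

theorem signType_mul_le_one (a b : SignType) : (a : ℝ) * b ≤ 1 := by
  rcases a with _ | _ | _ <;> rcases b with _ | _ | _ <;> simp

theorem sq_sub_ite_le_mul (a b : SignType) :
    (b : ℝ) ^ 2 - (if a ≠ b then 2 else 0) ≤ (a : ℝ) * b := by
  rcases a with _ | _ | _ <;> rcases b with _ | _ | _ <;> simp <;> norm_num

theorem liminf_prefixAverage_mul_pos {z t : ℕ+ → SignType}
    (hz : 0 < liminf (prefixAverage fun n => (z n : ℝ) ^ 2) atTop) {δ : ℝ}
    (hδ : 4 * δ < liminf (prefixAverage fun n => (z n : ℝ) ^ 2) atTop)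
    (h : ∀ N : ℕ, (((Finset.range N).filter
      fun n => t n.succPNat ≠ z n.succPNat).card : ℝ) ≤ δ * N) :
    0 < liminf (prefixAverage fun n => (t n : ℝ) * (z n : ℝ)) atTop := by
  set c := liminf (prefixAverage fun n => (z n : ℝ) ^ 2) atTop with hc
  have hev : ∀ᶠ N in atTop, c / 2 < prefixAverage (fun n => (z n : ℝ) ^ 2) N := by
    refine eventually_lt_of_lt_liminf (by rw [← hc]; linarith) ?_
    refine isBoundedUnder_of ⟨0, fun N => ?_⟩
    exact div_nonneg (Finset.sum_nonneg fun _ _ => sq_nonneg _) (Nat.cast_nonneg _)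
  -- The average of z² eventually exceeds c/2, and the disagreements, of density at most δ, lower it
  -- by at most 2 each.
  have hlow : ∀ᶠ N in atTop, c / 2 - 2 * δ ≤
      prefixAverage (fun n => (t n : ℝ) * (z n : ℝ)) N := by
    filter_upwards [hev, eventually_gt_atTop 0] with N hN hN0
    have hpos : (0 : ℝ) < N := Nat.cast_pos.2 hN0
    unfold prefixAverage at hN ⊢
    rw [lt_div_iff₀ hpos] at hN
    rw [le_div_iff₀ hpos]
    have hpt : ∑ n ∈ Finset.range N, ((z n.succPNat : ℝ) ^ 2 -
        if t n.succPNat ≠ z n.succPNat then 2 else 0) ≤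
        ∑ n ∈ Finset.range N, (t n.succPNat : ℝ) * (z n.succPNat : ℝ) := by
      refine Finset.sum_le_sum fun n _ => ?_
      exact sq_sub_ite_le_mul _ _
    rw [Finset.sum_sub_distrib, ← Finset.sum_filter, Finset.sum_const, nsmul_eq_mul] at hpt
    have := h N
    nlinarith
  refine (by linarith : 0 < c / 2 - 2 * δ).trans_le (le_liminf_of_le ?_ hlow)
  refine IsBoundedUnder.isCoboundedUnder_ge (isBoundedUnder_of ⟨1, fun N => ?_⟩)
  refine div_le_one_of_le₀ ?_ (Nat.cast_nonneg _)
  calc _ ≤ ∑ n ∈ Finset.range N, (1 : ℝ) := by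
        refine Finset.sum_le_sum fun n _ => ?_
        exact signType_mul_le_one _ _
    _ = N := by simp

/-! ### Passage to positive indices -/

/-- The Toeplitz sequence `toeplitzCopy`, indexed by the positive integers. -/
def toeplitzSeq {A : Type*} (p : ℕ → ℕ) (hp : ∀ i, i < p i) (hm : Monotone p) (z : ℕ+ → A)
    (n : ℕ+) : A :=
  toeplitzCopy p hp hm (fun n => z n.succPNat) n.natPred

section

variable {A : Type*} {p : ℕ → ℕ}

theorem isToeplitz_toeplitzSeq (hp : ∀ i, i < p i) (hm : Monotone p)
    (hd : ∀ i j, i ≤ j → p i ∣ p j) (z : ℕ+ → A) : IsToeplitz (toeplitzSeq p hp hm z) := by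
  intro a
  have hr : 0 < p (toeplitzLevel p hp hm a.natPred + 1) := (Nat.zero_le _).trans_lt (hp _)
  refine ⟨Nat.toPNat _ hr, fun k => ?_⟩
  have hk : (a + k * Nat.toPNat _ hr).natPred =
      a.natPred + k * p (toeplitzLevel p hp hm a.natPred + 1) := by
    have h1 : ((a + k * Nat.toPNat _ hr : ℕ+) : ℕ) =
        a + k * p (toeplitzLevel p hp hm a.natPred + 1) := rfl
    have h2 := PNat.natPred_add_one a
    have h3 := PNat.natPred_add_one (a + k * Nat.toPNat _ hr)
    omega
  unfold toeplitzSeq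
  rw [hk, toeplitzCopy_add hp hm hd]

theorem toeplitzSeq_eq (hp : ∀ i, i < p i) (hm : Monotone p) (z : ℕ+ → A) (n : ℕ)
    (h : ¬ repeated p 0 n) : toeplitzSeq p hp hm z n.succPNat = z n.succPNat := by
  unfold toeplitzSeq
  rw [Nat.natPred_succPNat]
  exact toeplitzCopy_eq hp hm _ n h

end

/-! ### Entropy comparison -/

/-- For a suitable N ≥ n, more than fN starts carry B, while at most n · c · 2N ≤ fN windows meet a
repeated position; the factor 2 covers windows that reach beyond N. -/
theorem exists_window_not_repeated {A : Type*} [TopologicalSpace A] [DiscreteTopology A]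
    [MeasurableSpace A] [MeasurableSingletonClass A] {w : ℕ+ → A} {ν : Measure (ℕ+ → A)}
    (h : IsQuasiGeneric seqShift w ν) {p : ℕ → ℕ} (hp : ∀ i, i < p i) (hm : Monotone p)
    {j n : ℕ} {c f : ℝ} (hc : 0 ≤ c) (hcf : c * (2 * n) ≤ f)
    (hpc : ∀ i, j ≤ i → (p i : ℝ) ≤ c * (1 / 2) ^ (i + 1) * p (i + 1)) (B : Fin n → A)
    (hf : f < ν.real (blockCylinder 1 B)) :
    ∃ s : ℕ, ∀ i : Fin n, w (Nat.succPNat (s + i)) = B i ∧ ¬ repeated p j (s + i) := by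
  classical
  obtain ⟨N, hnN, hN, hlt⟩ := h.exists_frequency_gt B hf n
  by_contra hcon
  push Not at hcon
  have h1 : ((Finset.Icc 1 N).filter fun s => ∀ i : Fin n, w (Nat.succPNat (s + i)) = B i).card ≤
      n * ((Finset.range (2 * N)).filter (repeated p j)).card := by
    refine le_trans (Finset.card_le_card fun s hs => ?_)
      (card_windows_hitting_le (repeated p j) n N (2 * N) (by omega))
    obtain ⟨hs, hs'⟩ := Finset.mem_filter.1 hs
    obtain ⟨i, hi⟩ := hcon s
    exact Finset.mem_filter.2 ⟨hs, i, hi (hs' i)⟩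
  have h2 := card_repeated_le hp hm hc hpc (2 * N)
  have h3 : (((Finset.Icc 1 N).filter fun s =>
      ∀ i : Fin n, w (Nat.succPNat (s + i)) = B i).card : ℝ) ≤ f * N := by
    calc _ ≤ (n : ℝ) * (((Finset.range (2 * N)).filter (repeated p j)).card : ℝ) := by
          exact_mod_cast h1
      _ ≤ n * (c * (2 * N : ℕ)) := mul_le_mul_of_nonneg_left h2 (Nat.cast_nonneg _)
      _ = c * (2 * n) * N := by push_cast; ring
      _ ≤ f * N := mul_le_mul_of_nonneg_right hcf (Nat.cast_nonneg _)
  exact absurd hlt (not_lt.2 h3)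

/-- Each B is read off z² in a window free of repetitions of levels ≥ j. The three factors count the
start modulo p_j, the block of the Toeplitz sequence seen there, and the symbols of B at the places
possibly spoiled by lower levels. -/
theorem ncard_suppBlocks_le {z : ℕ+ → SignType} {ν : Measure (ℕ+ → SignType)}
    (h : IsQuasiGeneric seqShift (z ^ 2) ν) {p : ℕ → ℕ} (hp : ∀ i, i < p i) (hm : Monotone p)
    (hd : ∀ i j, i ≤ j → p i ∣ p j) {j k : ℕ} {c f δ : ℝ} (hc : 0 ≤ c)
    (hcf : c * (2 * (k * p j : ℕ)) ≤ f) (hδ : 0 ≤ δ)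
    (hpc : ∀ i, j ≤ i → (p i : ℝ) ≤ c * (1 / 2) ^ (i + 1) * p (i + 1))
    (hpδ : ∀ i, (p i : ℝ) ≤ δ * (1 / 2) ^ (i + 1) * p (i + 1))
    (hf : ∀ B ∈ suppBlocks ν (k * p j), f < ν.real (blockCylinder 1 B)) :
    (suppBlocks ν (k * p j)).ncard ≤ p j * (blocks (toeplitzSeq p hp hm z) (k * p j)).ncard *
      3 ^ ⌊δ * (k * p j : ℕ)⌋₊ := by
  classical
  set n := k * p j with hn
  have hpos : ∀ i, 0 < p i := fun i => (Nat.zero_le _).trans_lt (hp i)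
  -- The condition `p (l + 1) ≤ n` of `repeated` is dropped, so that the set depends only on the
  -- start modulo p_j.
  let E : ℕ → Finset (Fin n) := fun r =>
    Finset.univ.filter fun i => ∃ l < j, (r + i) % p (l + 1) < p l
  have hE : ∀ r, (E r).card ≤ ⌊δ * (n : ℕ)⌋₊ := by
    intro r
    refine Nat.le_floor ((Nat.cast_le.2 ?_).trans (card_window_le hm hpos hd hδ hpδ j k r))
    refine Finset.card_le_card_of_injOn (fun i => r + i) ?_ fun a _ b _ hab =>
      Fin.ext (by simpa using hab)
    intro i hi
    have hi' := (Finset.mem_filter.1 (Finset.mem_coe.1 hi)).2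
    exact Finset.mem_coe.2 (Finset.mem_filter.2
      ⟨Finset.mem_Ico.2 ⟨Nat.le_add_right _ _, Nat.add_lt_add_left i.2 r⟩, hi'⟩)
  let I : Finset (ℕ × (Fin n → SignType)) :=
    Finset.range (p j) ×ˢ (blocks (toeplitzSeq p hp hm z) n).toFinset
  have hsub : (suppBlocks ν n).toFinset ⊆ I.biUnion fun x =>
      {B : Fin n → SignType | ∀ i ∉ E x.1, B i = x.2 i ^ 2}.toFinset := by
    intro B hB
    obtain ⟨s, hs⟩ := exists_window_not_repeated h hp hm hc hcf hpc B
      (hf B (Set.mem_toFinset.1 hB))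
    refine Finset.mem_biUnion.2 ⟨(s % p j, fun i => toeplitzSeq p hp hm z (Nat.succPNat (s + i))),
      Finset.mem_product.2 ⟨Finset.mem_range.2 (Nat.mod_lt _ (hpos j)), ?_⟩, ?_⟩
    · refine Set.mem_toFinset.2 ⟨s.succPNat, fun i => ?_⟩
      refine congrArg _ (PNat.eq ?_)
      simp only [coe_posAdd, Nat.succPNat_coe]
      omega
    · refine Set.mem_toFinset.2 fun i hi => ?_
      have hz : toeplitzSeq p hp hm z (Nat.succPNat (s + i)) = z (Nat.succPNat (s + i)) := by
        refine toeplitzSeq_eq hp hm z _ ?_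
        rintro ⟨l, -, hl, hl'⟩
        by_cases hlj : j ≤ l
        · exact (hs i).2 ⟨l, hlj, hl, hl'⟩
        · refine hi (Finset.mem_filter.2 ⟨Finset.mem_univ _, l, not_le.1 hlj, ?_⟩)
          have : (s % p j + i) % p (l + 1) = (s + i) % p (l + 1) := by
            rw [Nat.add_mod, Nat.mod_mod_of_dvd _ (hd (l + 1) j (not_le.1 hlj)), ← Nat.add_mod]
          rwa [this]
      rw [← (hs i).1]
      exact congrArg (· ^ 2) hz.symm
  rw [Set.ncard_eq_toFinset_card', Set.ncard_eq_toFinset_card']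
  refine (Finset.card_le_card hsub).trans ((Finset.card_biUnion_le_card_mul _ _
    (3 ^ ⌊δ * (n : ℕ)⌋₊) fun x _ => ?_).trans_eq ?_)
  · rw [← Set.ncard_eq_toFinset_card']
    refine (ncard_agree_off_le (E x.1) fun i => x.2 i ^ 2).trans ?_
    exact Nat.pow_le_pow_right (Fintype.card_pos (α := SignType)) (hE _)
  · rw [Finset.card_product, Finset.card_range]

theorem logb_two_three_le : Real.logb 2 3 ≤ 2 := by
  rw [Real.logb_le_iff_le_rpow (by norm_num) (by norm_num)]
  norm_num

/-- Along M = (j+1) p_j the residue factor contributes log₂(p_j) / M ≤ 1/(j+1), which vanishes; the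
last factor contributes at most 2δ since log₂ 3 ≤ 2. -/
theorem suppEntropy_le_topEntropy_add {w : ℕ+ → SignType} {ν : Measure (ℕ+ → SignType)}
    [IsProbabilityMeasure ν] (hinv : MeasurePreserving seqShift ν ν) {p : ℕ → ℕ}
    (hp : ∀ i, i < p i) {δ : ℝ} (hδ : 0 ≤ δ)
    (h : ∀ j, (suppBlocks ν ((j + 1) * p j)).ncard ≤
      p j * (blocks w ((j + 1) * p j)).ncard * 3 ^ ⌊δ * ((j + 1) * p j : ℕ)⌋₊) :
    suppEntropy ν ≤ topEntropy w + 2 * δ := by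
  have hpos : ∀ i, 0 < p i := fun i => (Nat.zero_le _).trans_lt (hp i)
  have hM : Tendsto (fun j => (j + 1) * p j) atTop atTop :=
    tendsto_atTop_mono (fun j => (Nat.le_succ j).trans (Nat.le_mul_of_pos_right _ (hpos j)))
      tendsto_id
  have h1 := (tendsto_suppEntropy ν hinv).comp hM
  have h2 := (((tendsto_topEntropy w).comp hM).add_const (2 * δ)).add
    tendsto_one_div_add_atTop_nhds_zero_nat
  rw [add_zero] at h2
  refine le_of_tendsto_of_tendsto' h1 h2 fun j => ?_
  simp only [Function.comp_apply]
  have hj := h j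
  set M := (j + 1) * p j with hMdef
  have hM0 : (0 : ℝ) < M := Nat.cast_pos.2 (Nat.mul_pos j.succ_pos (hpos j))
  have hb : (0 : ℝ) < (blocks w M).ncard :=
    Nat.cast_pos.2 ((Set.ncard_pos (Set.toFinite _)).2 ⟨_, 1, fun i => rfl⟩)
  have hpj : (0 : ℝ) < p j := Nat.cast_pos.2 (hpos j)
  have hlogp : Real.logb 2 (p j) ≤ p j := by
    rw [Real.logb_le_iff_le_rpow (by norm_num) hpj, Real.rpow_natCast]
    exact_mod_cast (Nat.lt_two_pow_self).le
  have hlog : Real.logb 2 ((suppBlocks ν M).ncard : ℝ) ≤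
      p j + Real.logb 2 ((blocks w M).ncard : ℝ) + 2 * δ * M := by
    rcases Nat.eq_zero_or_pos (suppBlocks ν M).ncard with h0 | h0
    · rw [h0, Nat.cast_zero, Real.logb_zero]
      have : 0 ≤ Real.logb 2 ((blocks w M).ncard : ℝ) :=
        Real.logb_nonneg (by norm_num) (by exact_mod_cast hb)
      positivity
    · have h3 : Real.logb 2 ((suppBlocks ν M).ncard : ℝ) ≤
          Real.logb 2 ((p j : ℝ) * (blocks w M).ncard * 3 ^ ⌊δ * M⌋₊) :=
        Real.logb_le_logb_of_le (by norm_num) (Nat.cast_pos.2 h0) (by exact_mod_cast hj)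
      rw [Real.logb_mul (by positivity) (by positivity), Real.logb_mul hpj.ne' hb.ne',
        Real.logb_pow] at h3
      have h4 : (⌊δ * M⌋₊ : ℝ) * Real.logb 2 3 ≤ δ * M * 2 :=
        mul_le_mul (Nat.floor_le (by positivity)) logb_two_three_le
          (Real.logb_nonneg (by norm_num) (by norm_num)) (by positivity)
      linarith
  have hfrac : (1 : ℝ) / (j + 1) * M = p j := by
    rw [hMdef]; push_cast; field_simp
  rw [div_le_iff₀ hM0, add_mul, add_mul, div_mul_cancel₀ _ hM0.ne', hfrac]
  linarith

/-! ### The main theorem -/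

theorem mainTheorem4
    (z : ℕ+ → SignType)
    (hz : 0 < liminf (prefixAverage fun n => (z n : ℝ) ^ 2) atTop)
    (ν : Measure (ℕ+ → SignType)) [IsProbabilityMeasure ν]
    (hinv : MeasurePreserving seqShift ν ν)
    (ha : IsQuasiGeneric seqShift (z ^ 2) ν)
    (hb : 0 < suppEntropy ν)
    (hc : ∃ q b : ℕ, 2 ≤ q ∧ 1 ≤ b ∧
      ∀ m : ℕ, 1 ≤ m → HasAtMostErgodicComponents (seqShift^[q ^ m]) ν b)
    (ε : ℝ) (hε : 0 < ε) :
    ∃ t : ℕ+ → SignType, IsToeplitz t ∧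
      (1 - ε) * suppEntropy ν ≤ topEntropy t ∧
      0 < liminf (prefixAverage fun n => (t n : ℝ) * (z n : ℝ)) atTop := by
  classical
  set d := liminf (prefixAverage fun n => (z n : ℝ) ^ 2) atTop with hd
  obtain ⟨δ, hδ, hδε, hδd⟩ : ∃ δ : ℝ, 0 < δ ∧ 2 * δ ≤ ε * suppEntropy ν ∧ 4 * δ < d := by
    have hpos : 0 < ε * suppEntropy ν := mul_pos hε hb
    refine ⟨min (ε * suppEntropy ν / 2) (d / 5), lt_min (by linarith) (by linarith), ?_, ?_⟩
    · linarith [min_le_left (ε * suppEntropy ν / 2) (d / 5)]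
    · linarith [min_le_right (ε * suppEntropy ν / 2) (d / 5)]
  choose f hf0 hf using exists_pos_le_suppBlocks ν
  -- The bound δ controls the total density of changes; the other makes c · 2M ≤ f M, the `+ 1`
  -- keeping the denominator positive at M = 0.
  obtain ⟨p, hpos, hdvd, hp, hgrow⟩ := exists_dvd_chain
    (fun M => min δ (f M / (2 * (M + 1)))) fun M => lt_min hδ (div_pos (hf0 M) (by positivity))
  have hm : Monotone p :=
    monotone_nat_of_le_succ fun i => Nat.le_of_dvd (hpos _) (hdvd i)
  have hdiv : ∀ i j, i ≤ j → p i ∣ p j := fun i j hij => by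
    induction hij with
    | refl => exact dvd_rfl
    | step _ ih => exact ih.trans (hdvd _)
  have hpδ : ∀ i, (p i : ℝ) ≤ δ * (1 / 2) ^ (i + 1) * p (i + 1) := fun i => by
    refine (hgrow i 0 (Nat.zero_le _)).trans ?_
    gcongr
    exact min_le_left _ _
  refine ⟨toeplitzSeq p hp hm z, isToeplitz_toeplitzSeq hp hm hdiv z, ?_, ?_⟩
  · have := suppEntropy_le_topEntropy_add (w := toeplitzSeq p hp hm z) hinv hp hδ.le fun j => by
      refine ncard_suppBlocks_le ha hp hm hdiv
        (c := min δ (f ((j + 1) * p j) / (2 * (((j + 1) * p j : ℕ) + 1))))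
        (le_min hδ.le (div_nonneg (hf0 _).le (by positivity))) ?_ hδ.le ?_ hpδ (hf _)
      · have hfM := hf0 ((j + 1) * p j)
        generalize f ((j + 1) * p j) = F at hfM ⊢
        generalize (j + 1) * p j = M
        refine (mul_le_mul_of_nonneg_right (min_le_right _ _) (by positivity)).trans ?_
        rw [div_mul_eq_mul_div, div_le_iff₀ (by positivity)]
        nlinarith
      · intro i hi
        -- All levels i ≥ j respect the constant for M = (j+1) p_j, since M ≤ (i+1) p_i.
        exact hgrow i _ (Nat.mul_le_mul (Nat.succ_le_succ hi) (hm hi))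
    linarith
  · refine liminf_prefixAverage_mul_pos hz hδd fun N => ?_
    refine le_trans (Nat.cast_le.2 (Finset.card_le_card fun n hn => ?_))
      (card_repeated_le (j := 0) hp hm hδ.le (fun i _ => hpδ i) N)
    obtain ⟨hn, hne⟩ := Finset.mem_filter.1 hn
    refine Finset.mem_filter.2 ⟨hn, ?_⟩
    by_contra hrep
    exact hne (toeplitzSeq_eq hp hm z n hrep)
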